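/- Let $(A,\mathfrak m,k)$ be a Noetherian complete local ring containing a field, let $n\ge 0$, $x=(x_1,\dots,x_n)$, $R=A[[x]]$, and let $M$ be a finitely generated $R$-module such that $\dim_k M/\mathfrak mM<\infty$. For $1\le i\le n$, a polynomial $f\in A[x_1,\dots,x_i]$ is called a Weierstrass polynomial with respect to $x_i$ if $f=x_i^b+c_{b-1}x_i^{b-1}+\dots+c_0$ for some $b\ge 0$ and some $c_0,\dots,c_{b-1}\in A[x_1,\dots,x_{i-1}]$ whose constant terms lie in $\mathfrak m$. Then: 1. There exist an integer $s\ge n$ and polynomials $f_1,\dots,f_s\in A[x]$ such that the annihilator of $M$ satisfies $\operatorname{Ann}_R(M)=\langle f_1,\dots,f_s\rangle R$ and, for every $i=1,\dots,n$, the polynomial $f_{n-i+1}$ lies in $A[x_1,\dots,x_i]$ and is a Weierstrass polynomial with respect to $x_i$. 2. $M$ is polynomially presented: there are integers $p,q\ge 0$, a $q\times p$ matrix $T$ with entries in $A[x]$, and an exact sequence of $R$-modules $R^p\xrightarrow{\;T\;}R^q\to M\to 0$. -/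

import Mathlib

/-- `p` lies in `A[x₁, …, xᵢ]` and is a Weierstrass polynomial with respect to the variable `xᵢ`
over the local ring `A`:  `p = xᵢ ^ b + c_{b-1} xᵢ ^ (b-1) + ⋯ + c₀`, where every `c_j` is a
polynomial in the variables preceding `xᵢ` only, with constant term in the maximal ideal of `A`
(that is, `c_j` lies in the maximal ideal of `A[[x₁, …, xᵢ₋₁]]`). -/
def IsWeierstrassPolynomial {A : Type*} [CommRing A] [IsLocalRing A] {n : ℕ} (i : Fin n)
    (p : MvPolynomial (Fin n) A) : Prop :=
  ∃ (b : ℕ) (c : Fin b → MvPolynomial (Fin n) A),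
    (∀ j, c j ∈ MvPolynomial.supported A (Set.Iio i)) ∧
    (∀ j, MvPolynomial.constantCoeff (c j) ∈ IsLocalRing.maximalIdeal A) ∧
    p = MvPolynomial.X i ^ b + ∑ j : Fin b, c j * MvPolynomial.X i ^ (j : ℕ)

/-- The `A[[x]]`-module `M` is polynomially presented: there is an exact sequence
`A[[x]]ᵖ → A[[x]]^q → M → 0` whose first map is given by a `q × p` matrix with entries
in `A[x]`. -/
def IsPolynomiallyPresented {A : Type*} [CommRing A] {n : ℕ} (M : Type*) [AddCommGroup M]
    [Module (MvPowerSeries (Fin n) A) M] : Prop :=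
  ∃ (p q : ℕ) (T : Matrix (Fin q) (Fin p) (MvPolynomial (Fin n) A))
    (π : (Fin q → MvPowerSeries (Fin n) A) →ₗ[MvPowerSeries (Fin n) A] M),
    Function.Exact
      (Matrix.mulVecLin (T.map (fun t => (t : MvPowerSeries (Fin n) A)))) π ∧
    Function.Surjective π

/-! Each `X i` lies in the Jacobson radical of R and M/𝔪M is Artinian, so by Nakayama a power of `X
i` maps M into 𝔪M. Cayley–Hamilton over R then yields elements of Ann M congruent to powers of the
`X i` modulo 𝔪R. Dividing by them, which completeness of A permits, shows that M is finite over A.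
Now Cayley–Hamilton applies over A itself: some monic polynomial in `X i` alone, with lower
coefficients in 𝔪, kills M. These are the Weierstrass polynomials w. Dividing by w gives R = A[x] +
(w), so an R-submodule of a finite free module that contains all multiples by the w is generated by
its polynomial elements, finitely many since A[x] is Noetherian. This applies to Ann M and to the
kernel of any surjection from a finite free module to M. -/

open IsLocalRing

/-! ### Adic completeness of products -/

section PiComplete

variable {A : Type*} [CommRing A] {I : Ideal A} {ι M : Type*} [AddCommGroup M] [Module A M]

theorem Submodule.mem_span_range_smul_top_iff {κ : Type*} [Fintype κ] (a : κ → A) (x : M) :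
    x ∈ (Ideal.span (Set.range a) • ⊤ : Submodule A M) ↔ ∃ y : κ → M, x = ∑ j, a j • y j := by
  constructor
  · intro hx
    induction hx using Submodule.smul_induction_on' with
    | smul r hr m _ =>
      obtain ⟨c, rfl⟩ := (Submodule.mem_span_range_iff_exists_fun A).1 hr
      exact ⟨fun j => c j • m, by simp [Finset.sum_smul, smul_smul, mul_comm]⟩
    | add u _ v _ hu hv =>
      obtain ⟨y, rfl⟩ := hu
      obtain ⟨z, rfl⟩ := hv
      exact ⟨y + z, by simp [Finset.sum_add_distrib]⟩
  · rintro ⟨y, rfl⟩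
    exact Submodule.sum_mem _ fun j _ =>
      Submodule.smul_mem_smul (Ideal.subset_span ⟨j, rfl⟩) trivial

/-- The index type may be infinite (exponents of power series); finite generation lets all
coordinates share one finite list of coefficients. -/
theorem Submodule.mem_smul_top_pi_iff (hI : I.FG) (x : ι → M) :
    x ∈ (I • ⊤ : Submodule A (ι → M)) ↔ ∀ i, x i ∈ (I • ⊤ : Submodule A M) := by
  obtain ⟨k, a, rfl⟩ := Submodule.fg_iff_exists_fin_generating_family.1 hI
  refine (Submodule.mem_span_range_smul_top_iff a x).trans ⟨?_, fun h => ?_⟩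
  · rintro ⟨y, rfl⟩ i
    exact (Submodule.mem_span_range_smul_top_iff a _).2 ⟨fun j => y j i, by simp⟩
  · choose y hy using fun i => (Submodule.mem_span_range_smul_top_iff a (x i)).1 (h i)
    exact ⟨fun j i => y i j, funext fun i => by simp [hy i]⟩

theorem IsPrecomplete.pi (hI : I.FG) [IsPrecomplete I M] : IsPrecomplete I (ι → M) := by
  refine ⟨fun f hf => ?_⟩
  have key (n : ℕ) (u v : ι → M) : u ≡ v [SMOD (I ^ n • ⊤ : Submodule A (ι → M))] ↔
      ∀ i, u i ≡ v i [SMOD (I ^ n • ⊤ : Submodule A M)] := by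
    simp only [SModEq.sub_mem]
    exact Submodule.mem_smul_top_pi_iff (hI.pow) _
  choose L hL using fun i => IsPrecomplete.prec ‹IsPrecomplete I M› (f := fun n => f n i)
    fun {m n} hmn => (key m _ _).1 (hf hmn) i
  exact ⟨L, fun n => (key n _ _).2 fun i => hL i n⟩

theorem IsHausdorff.pi (hI : I.FG) [IsHausdorff I M] : IsHausdorff I (ι → M) := by
  refine ⟨fun x hx => _root_.funext fun i => IsHausdorff.haus ‹IsHausdorff I M› _ fun n => ?_⟩
  have := hx n
  rw [SModEq.zero] at this ⊢
  exact (Submodule.mem_smul_top_pi_iff hI.pow _).1 this i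

end PiComplete

/-! ### Nakayama, Cayley–Hamilton and finiteness -/

/-- The ranges of the powers of x stabilise, and the stable range L satisfies L = xL, so it vanishes
by Nakayama. -/
theorem IsArtinian.exists_pow_smul_eq_zero {R Q : Type*} [CommRing R] [AddCommGroup Q] [Module R Q]
    [IsArtinian R Q] [Module.Finite R Q] {x : R} (hx : x ∈ Ideal.jacobson (⊥ : Ideal R)) :
    ∃ N : ℕ, ∀ q : Q, x ^ N • q = 0 := by
  obtain ⟨N, hN⟩ := IsArtinian.range_smul_pow_stabilizes Q x
  refine ⟨N, fun q => ?_⟩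
  have hbot : LinearMap.range (x ^ N • LinearMap.id : Q →ₗ[R] Q) = ⊥ := by
    refine Submodule.eq_bot_of_le_smul_of_le_jacobson_bot (Ideal.span {x}) _
      (by rw [LinearMap.range_eq_map]; exact Module.Finite.fg_top.map _) ?_ (by simpa using hx)
    rintro _ ⟨y, rfl⟩
    obtain ⟨z, hz⟩ := (hN (N + 1) N.le_succ).le ⟨y, rfl⟩
    rw [← hz]
    have : (x ^ (N + 1) • LinearMap.id : Q →ₗ[R] Q) z
        = x • (x ^ N • LinearMap.id : Q →ₗ[R] Q) z := by
      simp [pow_succ', mul_smul]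
    rw [this]
    exact Submodule.smul_mem_smul (Ideal.mem_span_singleton_self x) ⟨z, rfl⟩
  have : x ^ N • q ∈ LinearMap.range (x ^ N • LinearMap.id : Q →ₗ[R] Q) := ⟨q, rfl⟩
  rwa [hbot, Submodule.mem_bot] at this

theorem Ideal.mem_map_smul_top_iff {A R M : Type*} [CommRing A] [CommRing R] [Algebra A R]
    [AddCommGroup M] [Module R M] [Module A M] [IsScalarTower A R M] (I : Ideal A) (m : M) :
    m ∈ (I.map (algebraMap A R) • ⊤ : Submodule R M) ↔ m ∈ (I • ⊤ : Submodule A M) := by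
  rw [← Submodule.restrictScalars_mem A, Ideal.smul_restrictScalars,
    Submodule.restrictScalars_top]

theorem exists_pow_smul_mem_smul_top {A R M : Type*} [CommRing A] [CommRing R] [Algebra A R]
    [AddCommGroup M] [Module R M] [Module A M] [IsScalarTower A R M] [Module.Finite R M]
    (I : Ideal A) [I.IsMaximal]
    (hM : Module.Finite (A ⧸ I) (M ⧸ (I • ⊤ : Submodule A M)))
    {x : R} (hx : x ∈ Ideal.jacobson (⊥ : Ideal R)) :
    ∃ N : ℕ, 0 < N ∧ ∀ m : M, x ^ N • m ∈ (I • ⊤ : Submodule A M) := by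
  let := Ideal.Quotient.field I
  have hart : IsArtinian (A ⧸ I) (M ⧸ (I • ⊤ : Submodule A M)) := inferInstance
  have : IsArtinian A (M ⧸ (I • ⊤ : Submodule A M)) :=
    isArtinian_of_surjective_algebraMap (R := A ⧸ I) Ideal.Quotient.mk_surjective
  set L : Submodule R M := I.map (algebraMap A R) • ⊤ with hL
  let φ : (M ⧸ (I • ⊤ : Submodule A M)) →ₗ[A] M ⧸ L :=
    Submodule.liftQ _ (L.mkQ.restrictScalars A) fun m hm => by
      rw [← Ideal.mem_map_smul_top_iff (R := R)] at hm
      simpa using hm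
  have hφ : Function.Surjective φ := fun q => by
    obtain ⟨m, rfl⟩ := L.mkQ_surjective q
    exact ⟨Submodule.Quotient.mk m, rfl⟩
  have : IsArtinian A (M ⧸ L) := isArtinian_of_surjective _ φ hφ
  have : IsArtinian R (M ⧸ L) := isArtinian_of_tower A this
  obtain ⟨N, hN⟩ := IsArtinian.exists_pow_smul_eq_zero (Q := M ⧸ L) hx
  -- The extra factor keeps the exponent positive, as `Polynomial.expand` needs later.
  refine ⟨N + 1, N.succ_pos, fun m => ?_⟩
  rw [← Ideal.mem_map_smul_top_iff (R := R), ← hL, ← Submodule.Quotient.mk_eq_zero,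
    Submodule.Quotient.mk_smul, pow_succ', mul_smul, hN, smul_zero]

/-- Cayley–Hamilton for multiplication by x ^ N, followed by the substitution T ↦ T ^ N. -/
theorem exists_monic_coeff_mem_aeval_mem_annihilator {B R M : Type*} [CommRing B] [CommRing R]
    [Algebra B R] [AddCommGroup M] [Module R M] [Module B M] [IsScalarTower B R M]
    [Module.Finite B M] (I : Ideal B) (x : R) {N : ℕ} (hN : 0 < N)
    (hx : ∀ m : M, x ^ N • m ∈ (I • ⊤ : Submodule B M)) :
    ∃ p : Polynomial B, p.Monic ∧ (∀ k < p.natDegree, p.coeff k ∈ I) ∧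
      Polynomial.aeval x p ∈ Module.annihilator R M := by
  obtain ⟨p, hp, -, hI, h0⟩ :=
    LinearMap.exists_monic_and_natDegree_eq_and_coeff_mem_pow_and_aeval_eq_zero B
      (Algebra.lsmul B B M (x ^ N)) I (by rintro _ ⟨m, rfl⟩; exact hx m)
  refine ⟨Polynomial.expand B N p, hp.expand hN, fun k hk => ?_,
    Module.mem_annihilator.2 fun m => ?_⟩
  · rw [Polynomial.coeff_expand hN]
    split_ifs with hd
    · obtain ⟨l, rfl⟩ := hd
      rw [Polynomial.natDegree_expand, mul_comm p.natDegree] at hk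
      rw [Nat.mul_div_cancel_left _ hN]
      exact Ideal.pow_le_self (Nat.sub_ne_zero_of_lt (lt_of_mul_lt_mul_left' hk)) (hI l)
    · exact I.zero_mem
  · rw [Polynomial.aeval_algHom_apply] at h0
    rw [Polynomial.expand_aeval]
    exact LinearMap.congr_fun h0 m

theorem Polynomial.Monic.aeval_sub_pow_mem_map {B R : Type*} [CommRing B] [CommRing R]
    [Algebra B R] {I : Ideal B} {p : Polynomial B} (hp : p.Monic)
    (hI : ∀ k < p.natDegree, p.coeff k ∈ I) (x : R) :
    Polynomial.aeval x p - x ^ p.natDegree ∈ I.map (algebraMap B R) := by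
  have h := congrArg (Polynomial.aeval x) hp.as_sum
  simp only [map_add, map_pow, aeval_X, map_sum, map_mul, aeval_C] at h
  rw [h, add_sub_cancel_left]
  exact Ideal.sum_mem _ fun k hk =>
    Ideal.mul_mem_right _ _ (Ideal.mem_map_of_mem _ (hI k (Finset.mem_range.1 hk)))

theorem Module.Finite.of_sub_mem_annihilator {A R M : Type*} [CommRing A] [CommRing R] [Algebra A R]
    [AddCommGroup M] [Module R M] [Module A M] [IsScalarTower A R M] [Module.Finite R M]
    {P : Submodule A R} (hP : P.FG) (h : ∀ r : R, ∃ p ∈ P, r - p ∈ Module.annihilator R M) :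
    Module.Finite A M := by
  obtain ⟨k, e, he⟩ := Module.Finite.exists_fin (R := R) (M := M)
  have hfg : (Submodule.map₂ (Algebra.lsmul A A M).toLinearMap P
      (Submodule.span A (Set.range e))).FG :=
    hP.map₂ _ (Submodule.fg_span (Set.finite_range e))
  refine ⟨?_⟩
  convert hfg
  refine (eq_top_iff.2 fun m _ => ?_).symm
  obtain ⟨c, rfl⟩ := (Submodule.mem_span_range_iff_exists_fun R).1 (he.ge (trivial : m ∈ ⊤))
  refine Submodule.sum_mem _ fun j _ => ?_
  obtain ⟨p, hp, hcp⟩ := h (c j)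
  have : c j • e j = p • e j := by
    rw [← sub_eq_zero, ← sub_smul, Module.mem_annihilator.1 hcp]
  rw [this]
  exact Submodule.apply_mem_map₂ (Algebra.lsmul A A M).toLinearMap hp
    (Submodule.subset_span ⟨j, rfl⟩)

/-! ### Division of power series -/

namespace MvPowerSeries

variable {A : Type*} [CommRing A] {σ : Type*}

theorem isHausdorff {I : Ideal A} (hI : I.FG) [IsHausdorff I A] :
    IsHausdorff I (MvPowerSeries σ A) :=
  IsHausdorff.pi (M := A) (ι := σ →₀ ℕ) hI

theorem isPrecomplete {I : Ideal A} (hI : I.FG) [IsPrecomplete I A] :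
    IsPrecomplete I (MvPowerSeries σ A) :=
  IsPrecomplete.pi (M := A) (ι := σ →₀ ℕ) hI

/-- A monomial whose exponent is not ≤ b is divisible by some X i ^ b i; `c` picks one such i, so
each monomial is counted once. -/
theorem exists_eq_sum_X_pow_mul_add_trunc' [Fintype σ] [DecidableEq σ] (b : σ →₀ ℕ)
    (r : MvPowerSeries σ A) :
    ∃ h : σ → MvPowerSeries σ A,
      r = ∑ i, X i ^ b i * h i + (trunc' A b r : MvPolynomial σ A) := by
  rcases isEmpty_or_nonempty σ with _ | _
  · exact ⟨0, by ext α; simp [coeff_trunc', Subsingleton.elim α b]⟩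
  have hex (α : σ →₀ ℕ) (hα : ¬ α ≤ b) : ∃ i, b i ≤ α i := by
    by_contra! hlt
    exact hα fun i => (hlt i).le
  choose! c hc using hex
  let H : σ → MvPowerSeries σ A := fun i β =>
    if ¬ β + Finsupp.single i (b i) ≤ b ∧ c (β + Finsupp.single i (b i)) = i
    then coeff (β + Finsupp.single i (b i)) r else 0
  have hH (i : σ) (β : σ →₀ ℕ) : coeff β (H i) =
      if ¬ β + Finsupp.single i (b i) ≤ b ∧ c (β + Finsupp.single i (b i)) = i
      then coeff (β + Finsupp.single i (b i)) r else 0 := rfl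
  refine ⟨H, ?_⟩
  ext α
  have hterm (i : σ) : coeff α (X i ^ b i * H i) =
      if c α = i then (if ¬ α ≤ b then coeff α r else 0) else 0 := by
    simp only [X_pow_eq, coeff_monomial_mul, one_mul, Finsupp.single_le_iff]
    by_cases hi : b i ≤ α i
    · rw [if_pos hi, hH, tsub_add_cancel_of_le (Finsupp.single_le_iff.2 hi), ← ite_and]
      exact if_congr and_comm rfl rfl
    · rw [if_neg hi]
      split_ifs with h1 h2
      · rfl
      · exact absurd (h1 ▸ hc α h2) hi
      · rfl
  rw [map_add, map_sum, MvPolynomial.coeff_coe, coeff_trunc', Finset.sum_congr rfl fun i _ => hterm i,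
    Finset.sum_ite_eq, if_pos (Finset.mem_univ _)]
  by_cases h : α ≤ b <;> simp [h]

theorem exists_mvPolynomial_sub_mem_span [Fintype σ] [DecidableEq σ] {I : Ideal A} (hI : I.FG)
    [IsAdicComplete I A] (b : σ →₀ ℕ) (g : σ → MvPowerSeries σ A)
    (hg : ∀ i, g i - X i ^ b i ∈ I.map (algebraMap A (MvPowerSeries σ A)))
    (r : MvPowerSeries σ A) :
    ∃ p : MvPolynomial σ A, p.support ⊆ Finset.Iic b ∧ r - p ∈ Ideal.span (Set.range g) := by
  have := isHausdorff (σ := σ) hI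
  have := isPrecomplete (σ := σ) hI
  have := IsPrecomplete.pi (ι := Option σ) (M := MvPowerSeries σ A) hI
  -- Modulo I each `g i` is a power of `X i`, so Φ is surjective there by the plain monomial
  -- division; a precomplete source and Hausdorff target lift this to surjectivity.
  let Φ : (Option σ → MvPowerSeries σ A) →ₗ[A] MvPowerSeries σ A :=
    ∑ i, LinearMap.mulLeft A (g i) ∘ₗ LinearMap.proj (some i) +
      (MvPolynomial.coeToMvPowerSeries.algHom A).toLinearMap ∘ₗ trunc' A b ∘ₗ LinearMap.proj none
  have hΦ (h : Option σ → MvPowerSeries σ A) :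
      Φ h = ∑ i, g i * h (some i) + (trunc' A b (h none) : MvPolynomial σ A) := by
    simp [Φ, MvPolynomial.coeToMvPowerSeries.algHom_apply]
  have hsurj : Function.Surjective Φ := by
    refine surjective_of_mkQ_comp_surjective (I := I) fun q => ?_
    obtain ⟨s, rfl⟩ := Submodule.mkQ_surjective _ q
    obtain ⟨h, hh⟩ := exists_eq_sum_X_pow_mul_add_trunc' b s
    refine ⟨fun o => o.elim s h, ?_⟩
    have hsub : Φ (fun o => o.elim s h) - s = ∑ i, (g i - X i ^ b i) * h i := by
      simp only [hΦ, Option.elim, sub_mul, Finset.sum_sub_distrib]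
      linear_combination -hh
    rw [LinearMap.comp_apply, ← sub_eq_zero, ← map_sub, ← LinearMap.mem_ker, Submodule.ker_mkQ,
      Ideal.smul_top_eq_map, Submodule.restrictScalars_mem, hsub]
    exact Ideal.sum_mem _ fun i _ => Ideal.mul_mem_right _ _ (hg i)
  obtain ⟨h, rfl⟩ := hsurj r
  refine ⟨trunc' A b (h none), fun α hα => ?_, ?_⟩
  · by_contra hle
    rw [Finset.mem_Iic] at hle
    exact MvPolynomial.mem_support_iff.1 hα (by rw [coeff_trunc', if_neg hle])
  · rw [hΦ, add_sub_cancel_right]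
    exact Ideal.sum_mem _ fun i _ => Ideal.mul_mem_right _ _ (Ideal.subset_span ⟨i, rfl⟩)

theorem finite_of_sub_X_pow_mem [Fintype σ] {M : Type*} [AddCommGroup M]
    [Module (MvPowerSeries σ A) M] [Module A M] [IsScalarTower A (MvPowerSeries σ A) M]
    [Module.Finite (MvPowerSeries σ A) M] {I : Ideal A} (hI : I.FG) [IsAdicComplete I A]
    (b : σ →₀ ℕ) (g : σ → MvPowerSeries σ A)
    (hg : ∀ i, g i - X i ^ b i ∈ I.map (algebraMap A (MvPowerSeries σ A)))
    (hgM : ∀ i, g i ∈ Module.annihilator (MvPowerSeries σ A) M) : Module.Finite A M := by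
  classical
  refine Module.Finite.of_sub_mem_annihilator (R := MvPowerSeries σ A)
    (P := Submodule.span A ((fun α => monomial α 1) '' (Finset.Iic b : Set (σ →₀ ℕ))))
    (Submodule.fg_span ((Finset.finite_toSet _).image _)) fun r => ?_
  obtain ⟨p, hp, hr⟩ := exists_mvPolynomial_sub_mem_span hI b g hg r
  refine ⟨p, ?_, Ideal.span_le.2 (by rintro _ ⟨i, rfl⟩; exact hgM i) hr⟩
  rw [p.as_sum, ← MvPolynomial.coeToMvPowerSeries.ringHom_apply, map_sum]
  refine Submodule.sum_mem _ fun α hα => ?_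
  rw [MvPolynomial.coeToMvPowerSeries.ringHom_apply, MvPolynomial.coe_monomial]
  have : monomial α (p.coeff α) = p.coeff α • monomial (R := A) α 1 := by
    rw [← map_smul, smul_eq_mul, mul_one]
  rw [this]
  exact Submodule.smul_mem _ _ (Submodule.subset_span ⟨α, hp hα, rfl⟩)

end MvPowerSeries

/-! ### Weierstrass polynomials and polynomial generators -/

theorem Polynomial.Monic.isWeierstrassPolynomial_aeval_X {A : Type*} [CommRing A] [IsLocalRing A]
    {n : ℕ} {p : Polynomial A} (hp : p.Monic)
    (hm : ∀ k < p.natDegree, p.coeff k ∈ maximalIdeal A) (i : Fin n) :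
    IsWeierstrassPolynomial i (Polynomial.aeval (MvPolynomial.X i : MvPolynomial (Fin n) A) p) := by
  refine ⟨p.natDegree, fun j => MvPolynomial.C (p.coeff j), fun j => Subalgebra.algebraMap_mem _ _,
    fun j => by simpa using hm j j.2, ?_⟩
  have h := congrArg (Polynomial.aeval (MvPolynomial.X i : MvPolynomial (Fin n) A)) hp.as_sum
  simp only [map_add, map_pow, aeval_X, map_sum, map_mul, aeval_C] at h
  rw [h, Finset.sum_range]
  rfl

/-- Generators of the contraction of N to S^ι suffice: v ∈ N differs from a vector over S by a
combination of the vectors φ(f l)·eᵢ, which come from S and lie in N. -/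
theorem Submodule.exists_span_range_comp_eq {S R ι κ : Type*} [CommRing S] [IsNoetherianRing S]
    [CommRing R] [Finite ι] (φ : S →+* R) (f : κ → S) (N : Submodule R (ι → R))
    (hN : ∀ i v, φ (f i) • v ∈ N)
    (h : ∀ r : R, ∃ p : S, r - φ p ∈ Ideal.span (Set.range fun i => φ (f i))) :
    ∃ (k : ℕ) (t : Fin k → ι → S), Submodule.span R (Set.range fun j => φ ∘ t j) = N := by
  classical
  have := Fintype.ofFinite ι
  let N' : Submodule S (ι → S) :=
    { carrier := {v | φ ∘ v ∈ N}
      zero_mem' := by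
        have : φ ∘ (0 : ι → S) = 0 := by ext; simp
        simp [this]
      add_mem' := fun {u v} hu hv => by
        have : φ ∘ (u + v) = φ ∘ u + φ ∘ v := by ext; simp
        simpa [this] using N.add_mem hu hv
      smul_mem' := fun c v hv => by
        have : φ ∘ (c • v) = φ c • (φ ∘ v) := by ext; simp
        simpa [this] using N.smul_mem (φ c) hv }
  obtain ⟨k, t, ht⟩ := Submodule.fg_iff_exists_fin_generating_family.1
    (IsNoetherian.noetherian N')
  refine ⟨k, t, le_antisymm (Submodule.span_le.2 ?_) fun v hv => ?_⟩
  · rintro _ ⟨j, rfl⟩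
    exact ht.le (Submodule.subset_span ⟨j, rfl⟩)
  have hpoly (u : ι → S) (hu : φ ∘ u ∈ N) :
      φ ∘ u ∈ Submodule.span R (Set.range fun j => φ ∘ t j) := by
    obtain ⟨c, rfl⟩ := (Submodule.mem_span_range_iff_exists_fun S).1 (ht.ge hu)
    have : φ ∘ (∑ j, c j • t j) = ∑ j, φ (c j) • (φ ∘ t j) := by ext; simp
    rw [this]
    exact Submodule.sum_mem _ fun j _ =>
      Submodule.smul_mem _ _ (Submodule.subset_span ⟨j, rfl⟩)
  choose p hp using fun i => h (v i)
  have hw (i : ι) : (Pi.single i (v i - φ (p i)) : ι → R) ∈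
      N ⊓ Submodule.span R (Set.range fun j => φ ∘ t j) := by
    have hle : Ideal.span (Set.range fun l => φ (f l)) ≤ Submodule.comap
        (LinearMap.single R (fun _ : ι => R) i)
        (N ⊓ Submodule.span R (Set.range fun j => φ ∘ t j)) := by
      refine Ideal.span_le.2 ?_
      rintro _ ⟨l, rfl⟩
      have h1 : φ (f l) • (Pi.single i 1 : ι → R) ∈ N := hN l _
      have h2 : φ (f l) • (Pi.single i 1 : ι → R) = φ ∘ (Pi.single i (f l)) := by
        ext j
        by_cases hij : j = i
        · subst hij; simp
        · simp [hij]
      have h3 : LinearMap.single R (fun _ : ι => R) i (φ (f l)) = φ (f l) • Pi.single i 1 := by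
        rw [LinearMap.single_apply, ← Pi.single_smul, smul_eq_mul, mul_one]
      rw [SetLike.mem_coe, Submodule.mem_comap, h3]
      exact ⟨h1, by rw [h2] at h1 ⊢; exact hpoly _ h1⟩
    exact hle (hp i)
  have hsum : v = φ ∘ p + ∑ i, Pi.single i (v i - φ (p i)) := by
    rw [Finset.univ_sum_single]
    ext i
    simp
  have hmem := Submodule.sum_mem (N ⊓ Submodule.span R (Set.range fun j => φ ∘ t j))
    fun i (_ : i ∈ Finset.univ) => hw i
  rw [hsum]
  refine add_mem (hpoly p ?_) hmem.2
  rw [← sub_eq_of_eq_add hsum]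
  exact N.sub_mem hv hmem.1

theorem isPolynomiallyPresented_of_smul_eq_zero {A : Type*} [CommRing A] [IsNoetherianRing A]
    {n : ℕ} {M : Type*} [AddCommGroup M] [Module (MvPowerSeries (Fin n) A) M]
    [Module.Finite (MvPowerSeries (Fin n) A) M] {κ : Type*} (f : κ → MvPolynomial (Fin n) A)
    (hf : ∀ i, (f i : MvPowerSeries (Fin n) A) ∈ Module.annihilator (MvPowerSeries (Fin n) A) M)
    (h : ∀ r : MvPowerSeries (Fin n) A, ∃ p : MvPolynomial (Fin n) A,
      r - p ∈ Ideal.span (Set.range fun i => (f i : MvPowerSeries (Fin n) A))) :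
    IsPolynomiallyPresented (A := A) (n := n) M := by
  simp only [← MvPolynomial.coeToMvPowerSeries.ringHom_apply] at hf h
  obtain ⟨q, π, hπ⟩ := Module.Finite.exists_fin' (MvPowerSeries (Fin n) A) M
  have hker (i : κ) (v : Fin q → MvPowerSeries (Fin n) A) :
      MvPolynomial.coeToMvPowerSeries.ringHom (f i) • v ∈ LinearMap.ker π := by
    rw [LinearMap.mem_ker, map_smul]
    exact Module.mem_annihilator.1 (hf i) _
  obtain ⟨k, t, ht⟩ := Submodule.exists_span_range_comp_eq
    (MvPolynomial.coeToMvPowerSeries.ringHom (σ := Fin n) (R := A)) f (LinearMap.ker π) hker h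
  refine ⟨k, q, Matrix.of fun a j => t j a, π, LinearMap.exact_iff.2 ?_, hπ⟩
  rw [Matrix.range_mulVecLin, ← ht]
  rfl

theorem MvPowerSeries.X_mem_jacobson_bot {A σ : Type*} [CommRing A] [IsLocalRing A] (i : σ) :
    (MvPowerSeries.X i : MvPowerSeries σ A) ∈ Ideal.jacobson (⊥ : Ideal (MvPowerSeries σ A)) := by
  rw [jacobson_eq_maximalIdeal _ bot_ne_top, mem_maximalIdeal, mem_nonunits_iff,
    MvPowerSeries.isUnit_iff_constantCoeff, MvPowerSeries.constantCoeff_X]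
  exact not_isUnit_zero

theorem MvPowerSeries.finite_of_X_pow_smul_mem {A σ M : Type*} [CommRing A] [Fintype σ]
    [AddCommGroup M] [Module (MvPowerSeries σ A) M] [Module A M]
    [IsScalarTower A (MvPowerSeries σ A) M] [Module.Finite (MvPowerSeries σ A) M]
    {I : Ideal A} (hI : I.FG) [IsAdicComplete I A] {N : σ → ℕ} (hN0 : ∀ i, 0 < N i)
    (hN : ∀ i (m : M), (X i : MvPowerSeries σ A) ^ N i • m ∈ (I • ⊤ : Submodule A M)) :
    Module.Finite A M := by
  set J := Ideal.map (algebraMap A (MvPowerSeries σ A)) I with hJ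
  have hp (i : σ) : ∃ (d : ℕ) (g : MvPowerSeries σ A), g - X i ^ d ∈ J ∧
      g ∈ Module.annihilator (MvPowerSeries σ A) M := by
    -- M is not yet known to be finite over A, so the coefficients here are in R.
    obtain ⟨p, hp, hpI, hpM⟩ := exists_monic_coeff_mem_aeval_mem_annihilator J
      (X i : MvPowerSeries σ A) (hN0 i) fun m => (Ideal.mem_map_smul_top_iff I _).2 (hN i m)
    have h := hp.aeval_sub_pow_mem_map hpI (X i : MvPowerSeries σ A)
    rw [Algebra.algebraMap_self, Ideal.map_id] at h
    exact ⟨_, _, h, hpM⟩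
  choose d g hg hgM using hp
  exact finite_of_sub_X_pow_mem hI (Finsupp.equivFunOnFinite.symm d) g hg hgM

theorem MvPolynomial.coe_aeval_X {A σ : Type*} [CommRing A] (i : σ) (p : Polynomial A) :
    ((Polynomial.aeval (X i) p : MvPolynomial σ A) : MvPowerSeries σ A) =
      Polynomial.aeval (MvPowerSeries.X i) p := by
  have h := Polynomial.aeval_algHom_apply (MvPolynomial.coeToMvPowerSeries.algHom A)
    (X i : MvPolynomial σ A) p
  simpa [MvPolynomial.coeToMvPowerSeries.algHom_apply] using h.symm

theorem exists_isWeierstrassPolynomial_mem_annihilator {A : Type*} [CommRing A] [IsLocalRing A]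
    [IsNoetherianRing A] [IsAdicComplete (maximalIdeal A) A]
    {n : ℕ} {M : Type*} [AddCommGroup M] [Module (MvPowerSeries (Fin n) A) M]
    [Module A M] [IsScalarTower A (MvPowerSeries (Fin n) A) M]
    [Module.Finite (MvPowerSeries (Fin n) A) M]
    (hM : Module.Finite (A ⧸ maximalIdeal A) (M ⧸ (maximalIdeal A • ⊤ : Submodule A M))) :
    ∃ w : Fin n → MvPolynomial (Fin n) A, (∀ i, IsWeierstrassPolynomial i (w i)) ∧
      (∀ i, (w i : MvPowerSeries (Fin n) A) ∈ Module.annihilator (MvPowerSeries (Fin n) A) M) ∧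
      ∀ r : MvPowerSeries (Fin n) A, ∃ q : MvPolynomial (Fin n) A,
        r - q ∈ Ideal.span (Set.range fun i => (w i : MvPowerSeries (Fin n) A)) := by
  have hfg : (maximalIdeal A).FG := IsNoetherian.noetherian _
  choose N hN0 hN using fun i : Fin n => exists_pow_smul_mem_smul_top
    (R := MvPowerSeries (Fin n) A) (maximalIdeal A) hM (MvPowerSeries.X_mem_jacobson_bot i)
  have hfin : Module.Finite A M := MvPowerSeries.finite_of_X_pow_smul_mem hfg hN0 hN
  -- Finiteness over A now allows coefficients in A, so each result is a polynomial in one variable.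
  choose p hp hpI hpM using fun i => exists_monic_coeff_mem_aeval_mem_annihilator
    (maximalIdeal A) (MvPowerSeries.X i : MvPowerSeries (Fin n) A) (hN0 i) (hN i)
  refine ⟨fun i => Polynomial.aeval (MvPolynomial.X i) (p i),
    fun i => (hp i).isWeierstrassPolynomial_aeval_X (hpI i) i,
    fun i => by rw [MvPolynomial.coe_aeval_X]; exact hpM i, fun r => ?_⟩
  simp only [MvPolynomial.coe_aeval_X]
  obtain ⟨q, -, hq⟩ := MvPowerSeries.exists_mvPolynomial_sub_mem_span hfg
    (Finsupp.equivFunOnFinite.symm fun i => (p i).natDegree) _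
    (fun i => (hp i).aeval_sub_pow_mem_map (hpI i) (MvPowerSeries.X i)) r
  exact ⟨q, hq⟩

theorem Ideal.exists_eq_span_range_append {S R : Type*} [CommRing S] [IsNoetherianRing S]
    [CommRing R] (φ : S →+* R) {n : ℕ} (w : Fin n → S) (K : Ideal R) (hw : ∀ i, φ (w i) ∈ K)
    (h : ∀ r : R, ∃ p : S, r - φ p ∈ Ideal.span (Set.range fun i => φ (w i))) :
    ∃ (k : ℕ) (t : Fin k → S), K = Ideal.span (Set.range fun j => φ (Fin.append w t j)) := by
  obtain ⟨k, t, ht⟩ := Submodule.fg_iff_exists_fin_generating_family.1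
    (IsNoetherian.noetherian (K.comap φ))
  refine ⟨k, t, le_antisymm (fun r hr => ?_) (Ideal.span_le.2 ?_)⟩
  · obtain ⟨p, hp⟩ := h r
    have hw' : Ideal.span (Set.range fun i => φ (w i)) ≤
        Ideal.span (Set.range fun j => φ (Fin.append w t j)) := by
      refine Ideal.span_mono ?_
      rintro _ ⟨i, rfl⟩
      exact ⟨Fin.castAdd k i, by simp⟩
    have hpK : p ∈ K.comap φ := by
      rw [Ideal.mem_comap, ← sub_sub_cancel r (φ p)]
      exact K.sub_mem hr (Ideal.span_le.2 (by rintro _ ⟨i, rfl⟩; exact hw i) hp)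
    rw [← sub_add_cancel r (φ p)]
    refine add_mem (hw' hp) ?_
    have hle : K.comap φ ≤
        (Ideal.span (Set.range fun j => φ (Fin.append w t j))).comap φ := by
      rw [← ht, Submodule.span_le]
      rintro _ ⟨j, rfl⟩
      exact Ideal.subset_span ⟨Fin.natAdd n j, by simp⟩
    exact hle hpK
  · rintro _ ⟨j, rfl⟩
    refine Fin.addCases (fun i => ?_) (fun i => ?_) j
    · simpa using hw i
    · have : t i ∈ K.comap φ := ht.le (Submodule.subset_span ⟨i, rfl⟩)
      simpa using this

theorem corollary1p25 {A : Type*} [CommRing A] [IsLocalRing A] [IsNoetherianRing A]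
    [IsAdicComplete (IsLocalRing.maximalIdeal A) A]
    (hA : ∃ K : Subring A, IsField K)
    (n : ℕ) {M : Type*} [AddCommGroup M] [Module (MvPowerSeries (Fin n) A) M]
    [Module A M] [IsScalarTower A (MvPowerSeries (Fin n) A) M]
    [Module.Finite (MvPowerSeries (Fin n) A) M]
    (hM : Module.Finite (A ⧸ IsLocalRing.maximalIdeal A)
      (M ⧸ (IsLocalRing.maximalIdeal A • ⊤ : Submodule A M))) :
    (∃ (s : ℕ) (hs : n ≤ s) (f : Fin s → MvPolynomial (Fin n) A),
      (∀ i : Fin n, IsWeierstrassPolynomial i (f (Fin.castLE hs i.rev))) ∧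
      Module.annihilator (MvPowerSeries (Fin n) A) M =
        Ideal.span (Set.range fun j => (f j : MvPowerSeries (Fin n) A))) ∧
    IsPolynomiallyPresented (A := A) (n := n) M := by
  obtain ⟨w, hw, hwM, hdiv⟩ := exists_isWeierstrassPolynomial_mem_annihilator (n := n) hM
  refine ⟨?_, isPolynomiallyPresented_of_smul_eq_zero w hwM hdiv⟩
  obtain ⟨k, t, ht⟩ := Ideal.exists_eq_span_range_append
    -- The reversal matches the indexing f_{n-i+1}.
    (MvPolynomial.coeToMvPowerSeries.ringHom (σ := Fin n) (R := A)) (fun i => w i.rev)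
    (Module.annihilator (MvPowerSeries (Fin n) A) M) (fun i => hwM i.rev) fun r => by
      obtain ⟨q, hq⟩ := hdiv r
      refine ⟨q, ?_⟩
      rw [← Fin.rev_surjective.range_comp] at hq
      exact hq
  refine ⟨n + k, Nat.le_add_right n k, Fin.append (fun i => w i.rev) t, fun i => ?_, ht⟩
  have h : Fin.append (fun i => w i.rev) t (Fin.castLE (Nat.le_add_right n k) i.rev) = w i := by
    change Fin.append (fun i => w i.rev) t (Fin.castAdd k i.rev) = w i
    rw [Fin.append_left, Fin.rev_rev]
  rw [h]
  exact hw i
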